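/- **Setting.** Let $K\ge 2$ and let $\nu=(\nu_1,\dots,\nu_K)$ be $1$-sub-Gaussian probability distributions on $\mathbb{R}$ (that is, $\mathbb{E}_{X\sim\nu_i}[e^{\lambda(X-\mathbb{E}X)}]\le e^{\lambda^2/2}$ for all $\lambda\in\mathbb{R}$) with means $\mu_1,\dots,\mu_K$. Put $\mu_\star=\max_i\mu_i$, $\Delta_i=\mu_\star-\mu_i$, $\Delta_{\max}=\max_i\Delta_i$ and, if the means are not all equal, $\Delta_{\min}=\min\{\Delta_i : \Delta_i>0\}$. At each round $n=1,2,\dots$ an arm $I_n$ is chosen from the past information, and a reward $X_n$ is observed whose conditional law given that information is $\nu_{I_n}$. Let $N_{n,i}=\sum_{t<n}\mathbf 1\{I_t=i\}$ and $\mu_{n,i}=N_{n,i}^{-1}\sum_{t<n}X_t\mathbf 1\{I_t=i\}$. **Algorithm EB-TC$_{\varepsilon_0}$ with slack $\varepsilon_0>0$ and fixed proportion $\beta=1/2$.** Each arm is pulled once in the first $K$ rounds. At each round $n>K$, let (ties being broken arbitrarily) $$B_n=\hat\imath_n\in\arg\max_i\mu_{n,i},\qquad C_n\in\arg\min_{i\ne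 B_n}\frac{\mu_{n,B_n}-\mu_{n,i}+\varepsilon_0}{\sqrt{1/N_{n,B_n}+1/N_{n,i}}}.$$ Let $T_n(i,j)$ be the number of rounds $K<t<n$ with $(B_t,C_t)=(i,j)$, and $N^i_{n,j}$ the number of those rounds at which also $I_t=j$. Pull $I_n=C_n$ if $N^{B_n}_{n,C_n}\le(1-\beta)\,T_{n+1}(B_n,C_n)$, where $T_{n+1}(B_n,C_n)=T_n(B_n,C_n)+1$, and $I_n=B_n$ otherwise. The recommendation at round $n$ is $\hat\imath_n$. **Statement.** An agent that pulls $\hat\imath_n$ at each round $n>K$ has constant cumulative regret: 1. For all $K\ge2$, $\varepsilon_0>0$ and $\nu$ as above there is a constant $R$, which depends only on $(K,\varepsilon_0,\nu)$, such that $$\sum_{n=K+1}^{T}\mathbb{E}_\nu[\mu_\star-\mu_{\hat\imath_n}]\le R\qquad\text{for all } T>K.$$ 2. For every $\kappa>1$ there is a constant $c>0$, which depends only on $\kappa$, such that for all $K\ge 2$, all $\varepsilon_0>0$ and all $\nu$ as above whose means are not all equal and which satisfy $K/\min\{\Delta_{\min},\varepsilon_0\}^2\ge\kappa$, $$\sum_{n=K+1}^{T}\mathbb{E}_\nu[\mu_\star-\mu_{\hat\imath_n}]\le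 c\cdot\frac{K^3\Delta_{\max}}{\min\{\Delta_{\min},\varepsilon_0\}^2}\left(\log\frac{K}{\min\{\Delta_{\min},\varepsilon_0\}^2}\right)^2\qquad\text{for all } T>K.$$ -/

import Mathlib

open MeasureTheory ProbabilityTheory

namespace EBTC

noncomputable section

/-- A probability distribution on the real line is `1`-sub-Gaussian:
`E[exp (t (X - E[X]))] ≤ exp (t ^ 2 / 2)` for all real `t` (with these expectations finite). -/
def IsOneSubGaussian (ρ : Measure ℝ) : Prop :=
  HasSubgaussianMGF (fun x : ℝ => x - ∫ y, y ∂ρ) 1 ρ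

section Instance

variable {K : ℕ}

/-- Mean of arm `i`. -/
def armMean (ν : Fin K → Measure ℝ) (i : Fin K) : ℝ := ∫ x, x ∂(ν i)

/-- Largest mean. -/
def bestMean (ν : Fin K → Measure ℝ) : ℝ := ⨆ i, armMean ν i

/-- Sub-optimality gap of arm `i`. -/
def gap (ν : Fin K → Measure ℝ) (i : Fin K) : ℝ := bestMean ν - armMean ν i

/-- Largest gap. -/
def maxGap (ν : Fin K → Measure ℝ) : ℝ := ⨆ i, gap ν i

/-- Smallest positive gap (meaningful when some arm is sub-optimal). -/
def minGap (ν : Fin K → Measure ℝ) : ℝ := sInf {x : ℝ | ∃ i, 0 < gap ν i ∧ x = gap ν i}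

end Instance

section Statistics

/-! Statistics of a trajectory. Rounds are numbered from `1`. `I t` is the arm pulled at round `t`,
`X t` the reward observed, `B t` and `C t` the leader and the challenger (used for `t > K`). -/

variable {K : ℕ}

/-- Number of pulls of arm `i` before round `n`. -/
def pulls (I : ℕ → Fin K) (n : ℕ) (i : Fin K) : ℕ :=
  ((Finset.Ico 1 n).filter (fun t => I t = i)).card

/-- Empirical mean of arm `i` before round `n`. -/
def empMean (I : ℕ → Fin K) (X : ℕ → ℝ) (n : ℕ) (i : Fin K) : ℝ :=
  (∑ t ∈ (Finset.Ico 1 n).filter (fun t => I t = i), X t) / (pulls I n i : ℝ)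

/-- Number of rounds before `n` (and after the `K` initial ones) at which the pair
(leader, challenger) was `(i, j)`. -/
def pairCount (B C : ℕ → Fin K) (n : ℕ) (i j : Fin K) : ℕ :=
  ((Finset.Ioo K n).filter (fun t => B t = i ∧ C t = j)).card

/-- Number of those rounds at which, moreover, the challenger `j` was pulled. -/
def pairChallengerPulls (I B C : ℕ → Fin K) (n : ℕ) (i j : Fin K) : ℕ :=
  ((Finset.Ioo K n).filter (fun t => B t = i ∧ C t = j ∧ I t = j)).card

/-- Empirical transportation cost, with slack `ε₀`, of the leader `i` against the arm `j`. -/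
def transportCost (ε₀ : ℝ) (I : ℕ → Fin K) (X : ℕ → ℝ) (n : ℕ) (i j : Fin K) : ℝ :=
  (empMean I X n i - empMean I X n j + ε₀) /
    Real.sqrt (1 / (pulls I n i : ℝ) + 1 / (pulls I n j : ℝ))

/-- The trajectory follows the algorithm `EB-TC` with slack `ε₀` and fixed proportion `β`.
The leader `B n` is also the recommendation at round `n`. Ties are broken arbitrarily, and each arm
is pulled once, in an arbitrary order, during the first `K` rounds. -/
structure FollowsEBTC (ε₀ β : ℝ) (I : ℕ → Fin K) (X : ℕ → ℝ) (B C : ℕ → Fin K) : Prop where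
  init : ∀ i, pulls I (K + 1) i = 1
  leader : ∀ n, K < n → ∀ i, empMean I X n i ≤ empMean I X n (B n)
  challenger_ne : ∀ n, K < n → C n ≠ B n
  challenger : ∀ n, K < n → ∀ i, i ≠ B n →
    transportCost ε₀ I X n (B n) (C n) ≤ transportCost ε₀ I X n (B n) i
  tracking : ∀ n, K < n →
    I n = if (pairChallengerPulls I B C n (B n) (C n) : ℝ)
        ≤ (1 - β) * (pairCount B C (n + 1) (B n) (C n) : ℝ) then C n else B n

end Statistics

section Interaction

variable {K : ℕ} {Ω : Type*} {mΩ : MeasurableSpace Ω}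

/-- The random processes `I` (arms pulled), `X` (rewards), `B` (leaders, that is recommendations)
and `C` (challengers) come from running `EB-TC` with slack `ε₀` and fixed proportion `β` on the
bandit instance `ν`. The sigma-algebra `ℱ n` is the information available at round `n` before its
reward is drawn: it contains the past observations and may contain external randomness used to
break ties. Given `ℱ n`, the reward of round `n` has law `ν (I n)`. -/
structure IsEBTCRun (ε₀ β : ℝ) (ν : Fin K → Measure ℝ) (P : Measure Ω) (ℱ : Filtration ℕ mΩ)
    (I : ℕ → Ω → Fin K) (X : ℕ → Ω → ℝ) (B C : ℕ → Ω → Fin K) : Prop where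
  measurable_arm : ∀ n, 1 ≤ n → Measurable[ℱ n] (I n)
  measurable_reward : ∀ n, 1 ≤ n → Measurable[ℱ (n + 1)] (X n)
  measurable_leader : ∀ n, K < n → Measurable[ℱ n] (B n)
  measurable_challenger : ∀ n, K < n → Measurable[ℱ n] (C n)
  reward_law : ∀ n, 1 ≤ n → ∀ A : Set Ω, MeasurableSet[ℱ n] A → ∀ (i : Fin K) (s : Set ℝ),
    MeasurableSet s →
      P (A ∩ {ω | I n ω = i} ∩ {ω | X n ω ∈ s}) = P (A ∩ {ω | I n ω = i}) * ν i s
  follows : ∀ ω, FollowsEBTC ε₀ β (fun n => I n ω) (fun n => X n ω)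
    (fun n => B n ω) (fun n => C n ω)

/-- Cumulative regret, over the rounds `K + 1, …, T`, of the agent that pulls the recommended arm
`B n` at each round `n`. -/
def inducedRegret (ν : Fin K → Measure ℝ) (P : Measure Ω) (B : ℕ → Ω → Fin K) (T : ℕ) : ℝ :=
  ∑ n ∈ Finset.Icc (K + 1) T, ∫ ω, (bestMean ν - armMean ν (B n ω)) ∂P

end Interaction

end

end EBTC

/-! Let `m` be the minimum of `ε₀` and the smallest positive gap. For an integer level `D`, suppose
that an arm pulled `N` times has empirical mean within `m / 4 * √(max N D / N)` of its mean. At a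
round with a sub-optimal leader, if leader and challenger both had more than `4 * D` pulls, the
leader's mean would be known to within `m / 4`, so a best arm could be beaten only if it had fewer
than `D` pulls. The slack then makes that arm much cheaper than the challenger, which contradicts
the choice of the challenger (`FollowsEBTC.min_pulls_le`). Since tracking splits the pulls of each
pair (leader, challenger) evenly, every pair accounts for O(`D`) such rounds, hence O(`K ^ 2 * D`)
in all (`FollowsEBTC.card_subopt_le`).

The concentration event fails at level `D` with probability exponentially small in `D`, uniformly in
the horizon (`IsEBTCRun.measureReal_failure_le`): exponential supermartingales are stopped at a
number of pulls, so the union bound runs over pull counts and not over rounds. The number of bad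
rounds is controlled by the first level that does not fail; summing the failure probabilities over
levels bounds its expectation by a constant (`le_of_levels`, `IsEBTCRun.inducedRegret_le`). -/

namespace EBTC

/-! ### Deterministic counting: tracking and pairs (leader, challenger) -/

section Trajectory

variable {K : ℕ} {I : ℕ → Fin K} {X : ℕ → ℝ} {B C : ℕ → Fin K}

lemma pulls_succ {n : ℕ} (hn : 1 ≤ n) (i : Fin K) :
    pulls I (n + 1) i = pulls I n i + if I n = i then 1 else 0 := by
  unfold pulls
  rw [← Finset.insert_Ico_right_eq_Ico_add_one hn, Finset.filter_insert]
  split_ifs with h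
  · rw [Finset.card_insert_of_notMem (by simp)]
  · rfl

lemma pulls_mono (i : Fin K) : Monotone (fun n => pulls I n i) := by
  intro a b hab
  exact Finset.card_le_card (Finset.filter_subset_filter _ (Finset.Ico_subset_Ico_right hab))

lemma pulls_le (n : ℕ) (i : Fin K) : pulls I n i ≤ n - 1 := by
  simpa [pulls] using Finset.card_filter_le (Finset.Ico 1 n) (fun t => I t = i)

lemma pulls_lt_of_arm_eq {t n : ℕ} {i : Fin K} (ht : t ∈ Finset.Ico 1 n) (h : I t = i) :
    pulls I t i < pulls I n i := by
  rw [Finset.mem_Ico] at ht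
  have h1 : pulls I (t + 1) i ≤ pulls I n i := pulls_mono i ht.2
  rw [pulls_succ ht.1, if_pos h] at h1
  omega

lemma pairCount_succ (n : ℕ) (i j : Fin K) :
    pairCount B C (n + 1) i j = pairCount B C n i j +
      if K < n ∧ B n = i ∧ C n = j then 1 else 0 := by
  unfold pairCount
  by_cases hK : K < n
  · have : Finset.Ioo K (n + 1) = insert n (Finset.Ioo K n) := by ext; simp; omega
    rw [this, Finset.filter_insert]
    split_ifs <;> simp_all
  · have : Finset.Ioo K (n + 1) = Finset.Ioo K n := by ext; simp; omega
    simp [this, hK]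

lemma pairChallengerPulls_succ (n : ℕ) (i j : Fin K) :
    pairChallengerPulls I B C (n + 1) i j = pairChallengerPulls I B C n i j +
      if K < n ∧ B n = i ∧ C n = j ∧ I n = j then 1 else 0 := by
  unfold pairChallengerPulls
  by_cases hK : K < n
  · have : Finset.Ioo K (n + 1) = insert n (Finset.Ioo K n) := by ext; simp; omega
    rw [this, Finset.filter_insert]
    split_ifs <;> simp_all
  · have : Finset.Ioo K (n + 1) = Finset.Ioo K n := by ext; simp; omega
    simp [this, hK]

variable {ε₀ : ℝ}

/-- The tracking rule is self-correcting: whichever arm is pulled, twice the challenger's share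
stays within two of the pair count. The challenger differs from the leader, so a pull of the leader
never counts as a pull of the challenger. -/
lemma FollowsEBTC.tracking_bounds (h : FollowsEBTC ε₀ (1 / 2) I X B C) (n : ℕ) (i j : Fin K) :
    pairCount B C n i j ≤ 2 * pairChallengerPulls I B C n i j ∧
      2 * pairChallengerPulls I B C n i j ≤ pairCount B C n i j + 2 := by
  induction n with
  | zero => simp [pairCount, pairChallengerPulls]
  | succ n ih =>
    by_cases hn : K < n ∧ B n = i ∧ C n = j
    · obtain ⟨hK, rfl, rfl⟩ := hn
      have ht := h.tracking n hK
      have hne := h.challenger_ne n hK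
      have hP : K < n ∧ B n = B n ∧ C n = C n := ⟨hK, rfl, rfl⟩
      rw [pairCount_succ, if_pos hP] at ht ⊢
      rw [pairChallengerPulls_succ]
      push_cast at ht
      split_ifs at ht with hc
      · have hQ : K < n ∧ B n = B n ∧ C n = C n ∧ I n = C n := ⟨hK, rfl, rfl, ht⟩
        rw [if_pos hQ]
        have : 2 * pairChallengerPulls I B C n (B n) (C n) ≤ pairCount B C n (B n) (C n) + 1 := by
          have h2 : 2 * (pairChallengerPulls I B C n (B n) (C n) : ℝ) ≤
            pairCount B C n (B n) (C n) + 1 := by linarith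
          exact_mod_cast h2
        omega
      · rw [if_neg (fun hh => hne (by rw [← hh.2.2.2, ht]))]
        have : pairCount B C n (B n) (C n) + 1 < 2 * pairChallengerPulls I B C n (B n) (C n) := by
          have h2 : (pairCount B C n (B n) (C n) : ℝ) + 1 <
            2 * pairChallengerPulls I B C n (B n) (C n) := by linarith
          exact_mod_cast h2
        omega
    · rw [pairCount_succ, pairChallengerPulls_succ, if_neg hn,
        if_neg (fun hh => hn ⟨hh.1, hh.2.1, hh.2.2.1⟩)]
      exact ih

lemma pairChallengerPulls_le_pulls (n : ℕ) (i j : Fin K) :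
    pairChallengerPulls I B C n i j ≤ pulls I n j := by
  refine Finset.card_le_card fun t => ?_
  simp only [Finset.mem_filter, Finset.mem_Ioo, Finset.mem_Ico]
  rintro ⟨⟨h1, h2⟩, -, -, h3⟩
  exact ⟨⟨by omega, h2⟩, h3⟩

lemma FollowsEBTC.pairCount_le (h : FollowsEBTC ε₀ (1 / 2) I X B C) (n : ℕ) (i j : Fin K) :
    pairCount B C n i j ≤ pairChallengerPulls I B C n i j + pulls I n i := by
  have hsub : (Finset.Ioo K n).filter (fun t => B t = i ∧ C t = j) ⊆
      (Finset.Ioo K n).filter (fun t => B t = i ∧ C t = j ∧ I t = j) ∪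
        (Finset.Ico 1 n).filter (fun t => I t = i) := by
    intro t
    simp only [Finset.mem_filter, Finset.mem_Ioo, Finset.mem_Ico, Finset.mem_union]
    rintro ⟨⟨h1, h2⟩, rfl, rfl⟩
    have ht := h.tracking t h1
    split_ifs at ht with hc
    · exact Or.inl ⟨⟨h1, h2⟩, rfl, rfl, ht⟩
    · exact Or.inr ⟨⟨by omega, h2⟩, ht⟩
  exact (Finset.card_le_card hsub).trans (Finset.card_union_le _ _)

/-- Half of the rounds of a pair go to each arm, up to rounding, so a pair used often forces both of
its arms to be well sampled. -/
lemma FollowsEBTC.pairCount_le_pulls (h : FollowsEBTC ε₀ (1 / 2) I X B C) (n : ℕ)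
    (i j : Fin K) : pairCount B C n i j ≤ 2 * min (pulls I n i) (pulls I n j) + 2 := by
  have h1 := h.tracking_bounds n i j
  have h2 := h.pairCount_le n i j
  have h3 := pairChallengerPulls_le_pulls (I := I) (B := B) (C := C) n i j
  omega

lemma FollowsEBTC.one_le_pulls {β : ℝ} (h : FollowsEBTC ε₀ β I X B C) {n : ℕ} (hn : K < n)
    (i : Fin K) : 1 ≤ pulls I n i := by
  have := pulls_mono (I := I) i (Nat.succ_le_of_lt hn)
  simpa [h.init i] using this

/-- If, at every round of `S`, the pair (leader, challenger) has been used at most `q` times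
before, then `S` has at most `K ^ 2 * (q + 1)` elements. -/
lemma card_le_of_pairCount_le {S : Finset ℕ} {q : ℕ} (hS : ∀ n ∈ S, K < n)
    (hq : ∀ n ∈ S, pairCount B C n (B n) (C n) ≤ q) : S.card ≤ K ^ 2 * (q + 1) := by
  have h1 : ∀ p : Fin K × Fin K,
      (S.filter (fun n => (B n, C n) = p)).card ≤ q + 1 := by
    intro p
    rcases (S.filter (fun n => (B n, C n) = p)).eq_empty_or_nonempty with he | hne
    · simp [he]
    -- At the last round of `S` with this pair, all the other rounds of `F` are already in the pair
    -- count.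
    · set F := S.filter (fun n => (B n, C n) = p) with hF
      obtain ⟨hmS, hmp⟩ := Finset.mem_filter.1 (F.max'_mem hne)
      have hsub : F.erase (F.max' hne) ⊆ (Finset.Ioo K (F.max' hne)).filter
          (fun t => B t = B (F.max' hne) ∧ C t = C (F.max' hne)) := by
        intro t ht
        have htF := Finset.mem_of_mem_erase ht
        obtain ⟨htS, htp⟩ := Finset.mem_filter.1 htF
        have hlt := Finset.lt_max'_of_mem_erase_max' F hne ht
        rw [← hmp, Prod.mk.injEq] at htp
        exact Finset.mem_filter.2 ⟨Finset.mem_Ioo.2 ⟨hS t htS, hlt⟩, htp⟩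
      have h2 := (Finset.card_le_card hsub).trans (hq _ hmS)
      rw [Finset.card_erase_of_mem (F.max'_mem hne)] at h2
      omega
  have h3 := Finset.card_le_mul_card_image_of_maps_to (s := S)
    (f := fun n => (B n, C n)) (t := Finset.univ) (fun _ _ => Finset.mem_univ _) (q + 1)
    (fun p _ => h1 p)
  simpa [Fintype.card_prod, sq, mul_comm] using h3

end Trajectory

/-! ### Deterministic consequence of concentration -/

section Leader

variable {K : ℕ} {I : ℕ → Fin K} {X : ℕ → ℝ} {B C : ℕ → Fin K} {ε₀ : ℝ}

/-- Confidence width of an arm pulled `N` times, at scale `m` and level `D`. -/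
noncomputable def width (m : ℝ) (D N : ℕ) : ℝ := m / 4 * √((max N D : ℕ) / N)

lemma width_pos {m : ℝ} (hm : 0 < m) (D : ℕ) {N : ℕ} (hN : 1 ≤ N) : 0 < width m D N := by
  have h1 : (0 : ℝ) < N := by exact_mod_cast hN
  have h2 : (0 : ℝ) < (max N D : ℕ) := by exact_mod_cast lt_of_lt_of_le hN (le_max_left _ _)
  unfold width
  positivity

lemma width_of_le (m : ℝ) {D N : ℕ} (hN : 1 ≤ N) (h : D ≤ N) : width m D N = m / 4 := by
  have h1 : (N : ℝ) ≠ 0 := by positivity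
  simp [width, max_eq_left h, div_self h1]

/-- This is the sub-Gaussian exponent of a deviation by one width. It grows with `N`, so a union
over `N` is summable, and it is at least of order `D`, so the total decays with the level. -/
lemma mul_sq_width (m : ℝ) (D : ℕ) {N : ℕ} (hN : 1 ≤ N) :
    N * width m D N ^ 2 / 2 = m ^ 2 / 32 * (max N D : ℕ) := by
  have h1 : (N : ℝ) ≠ 0 := by positivity
  rw [width, mul_pow, Real.sq_sqrt (by positivity)]
  field_simp
  ring

/-- When all empirical means are within their confidence widths and the leader is sub-optimal, the
leader or the challenger is under-sampled. -/
lemma FollowsEBTC.min_pulls_le {β : ℝ} (h : FollowsEBTC ε₀ β I X B C) {μ : Fin K → ℝ} {m : ℝ}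
    (hm : 0 < m) (hmε : m ≤ ε₀) {n D : ℕ} (hn : K < n)
    (hE : ∀ i, |empMean I X n i - μ i| < width m D (pulls I n i))
    {s : Fin K} (hs : m ≤ μ s - μ (B n)) :
    min (pulls I n (B n)) (pulls I n (C n)) ≤ 4 * D := by
  by_contra! hlt
  obtain ⟨hb, hc⟩ := lt_min_iff.1 hlt
  have hEb := hE (B n)
  rw [width_of_le m (h.one_le_pulls hn _) (by omega), abs_lt] at hEb
  have hEs := abs_lt.1 (hE s)
  have hls := h.leader n hn s
  have hs1 := h.one_le_pulls hn s
  -- With at least `D` pulls, both means would be accurate to `m / 4`, too little to reverse a gap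
  -- of at least `m`.
  have hsD : pulls I n s < D := by
    by_contra! hD
    rw [width_of_le m hs1 hD] at hEs
    linarith
  have hsb : s ≠ B n := by rintro rfl; omega
  have hcost := h.challenger n hn s hsb
  unfold transportCost at hcost
  have hlc := h.leader n hn (C n)
  have hDpos : (0 : ℝ) < D := by exact_mod_cast (Nat.zero_le _).trans_lt hsD
  have hb' : 4 * (D : ℝ) < pulls I n (B n) := by exact_mod_cast hb
  have hc' : 4 * (D : ℝ) < pulls I n (C n) := by exact_mod_cast hc
  have hs' : (0 : ℝ) < pulls I n s := by exact_mod_cast hs1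
  have hsD' : (pulls I n s : ℝ) ≤ D := by exact_mod_cast hsD.le
  have hε : 0 < ε₀ := hm.trans_le hmε
  set b := (pulls I n (B n) : ℝ)
  set c := (pulls I n (C n) : ℝ)
  set r := (pulls I n s : ℝ)
  have hb0 : 0 < b := by linarith
  have hc0 : 0 < c := by linarith
  have hD0 : 0 < √(D : ℝ) := Real.sqrt_pos.2 hDpos
  -- lower bound on the cost of the challenger
  have hl : ε₀ * (√2 * √D) ≤
      (empMean I X n (B n) - empMean I X n (C n) + ε₀) / √(1 / b + 1 / c) := by
    have hq : √(1 / b + 1 / c) * (√2 * √D) ≤ 1 := by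
      rw [← Real.sqrt_mul (by norm_num), ← Real.sqrt_mul (by positivity)]
      refine Real.sqrt_le_one.2 ?_
      have e1 : 1 / b ≤ 1 / (4 * D) := one_div_le_one_div_of_le (by linarith) hb'.le
      have e2 : 1 / c ≤ 1 / (4 * D) := one_div_le_one_div_of_le (by linarith) hc'.le
      calc (1 / b + 1 / c) * (2 * D) ≤ (1 / (4 * D) + 1 / (4 * D)) * (2 * (D : ℝ)) := by gcongr
        _ = 1 := by field_simp; norm_num
    rw [le_div_iff₀ (Real.sqrt_pos.2 (by positivity))]
    nlinarith
  -- upper bound on the cost of the best arm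
  have hu : (empMean I X n (B n) - empMean I X n s + ε₀) / √(1 / b + 1 / r) ≤
      5 / 4 * (ε₀ * √D) := by
    -- Below `D` pulls the width is proportional to `√(D / r)`, so multiplying by `√r` removes the
    -- dependence on `r`.
    have hw : width m D (pulls I n s) * √r = m / 4 * √D := by
      rw [width, max_eq_right hsD.le, mul_assoc, ← Real.sqrt_mul (by positivity),
        div_mul_cancel₀ _ hs'.ne']
    have hr1 : 1 ≤ √r * √(1 / b + 1 / r) := by
      rw [← Real.sqrt_mul hs'.le]
      refine Real.one_le_sqrt.2 ?_
      rw [mul_add, mul_one_div_cancel hs'.ne']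
      have : 0 ≤ r * (1 / b) := by positivity
      linarith
    rw [div_le_iff₀ (Real.sqrt_pos.2 (by positivity))]
    have hnum : empMean I X n (B n) - empMean I X n s + ε₀ ≤ width m D (pulls I n s) + ε₀ := by
      linarith
    have hw0 := width_pos hm D hs1
    have hsq : √r ≤ √D := Real.sqrt_le_sqrt hsD'
    calc empMean I X n (B n) - empMean I X n s + ε₀
        ≤ (width m D (pulls I n s) + ε₀) * 1 := by linarith
      _ ≤ (width m D (pulls I n s) + ε₀) * (√r * √(1 / b + 1 / r)) := by gcongr
      _ = (m / 4 * √D + ε₀ * √r) * √(1 / b + 1 / r) := by rw [← hw]; ring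
      _ ≤ (ε₀ / 4 * √D + ε₀ * √D) * √(1 / b + 1 / r) := by gcongr
      _ = _ := by ring
  have hfin := hl.trans (hcost.trans hu)
  -- The threshold `4 * D` gives the factor `√2` in the lower bound; the slack and the width, with
  -- `m ≤ ε₀`, give `1 + 1 / 4` in the upper bound.
  have h2 : (5 / 4 : ℝ) < √2 := Real.lt_sqrt_of_sq_lt (by norm_num)
  nlinarith [mul_pos hε hD0]

/-- Number of rounds with a sub-optimal leader, when all empirical means are within their
confidence widths. -/
lemma FollowsEBTC.card_subopt_le (h : FollowsEBTC ε₀ (1 / 2) I X B C) {μ : Fin K → ℝ} {m : ℝ}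
    (hm : 0 < m) (hmε : m ≤ ε₀) {D : ℕ} {S : Finset ℕ} (hS : ∀ n ∈ S, K < n)
    (hE : ∀ n ∈ S, ∀ i, |empMean I X n i - μ i| < width m D (pulls I n i))
    {s : Fin K} (hs : ∀ n ∈ S, m ≤ μ s - μ (B n)) :
    S.card ≤ K ^ 2 * (8 * D + 3) := by
  refine card_le_of_pairCount_le hS (B := B) (C := C) (q := 8 * D + 2) fun n hn => ?_
  have h1 := h.min_pulls_le hm hmε (hS n hn) (hE n hn) (hs n hn)
  have h2 := h.pairCount_le_pulls n (B n) (C n)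
  omega

end Leader

end EBTC
namespace EBTC

/-! ### Exponential process of one arm, stopped at a pull count -/

section StoppedLikelihood

variable {K : ℕ}

/-- Logarithm of the exponential martingale with parameter `l` of the centred rewards of arm `i`,
stopped after `N` pulls of that arm. -/
noncomputable def logLik (I : ℕ → Fin K) (X : ℕ → ℝ) (i : Fin K) (μ l : ℝ) (N n : ℕ) : ℝ :=
  ∑ t ∈ Finset.Ico 1 n, if I t = i ∧ pulls I t i < N then l * (X t - μ) - l ^ 2 / 2 else 0

lemma logLik_succ (I : ℕ → Fin K) (X : ℕ → ℝ) (i : Fin K) (μ l : ℝ) (N : ℕ) {n : ℕ}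
    (hn : 1 ≤ n) : logLik I X i μ l N (n + 1) = logLik I X i μ l N n +
      if I n = i ∧ pulls I n i < N then l * (X n - μ) - l ^ 2 / 2 else 0 :=
  Finset.sum_Ico_succ_top hn _

/-- Stopping freezes the process once the arm has its `N` pulls, so its value at a single final time
`m` records the empirical mean at every earlier round `n` having that count. -/
lemma logLik_eq (I : ℕ → Fin K) (X : ℕ → ℝ) (i : Fin K) (μ l : ℝ) {n m : ℕ} (hn : 1 ≤ n)
    (hnm : n ≤ m) (hp : 1 ≤ pulls I n i) :
    logLik I X i μ l (pulls I n i) m =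
      pulls I n i * (l * (empMean I X n i - μ) - l ^ 2 / 2) := by
  have h0 : (pulls I n i : ℝ) ≠ 0 := by positivity
  have h1 : ∑ t ∈ Finset.Ico n m, (if I t = i ∧ pulls I t i < pulls I n i then
      l * (X t - μ) - l ^ 2 / 2 else 0) = 0 := by
    refine Finset.sum_eq_zero fun t ht => if_neg fun h => ?_
    exact absurd h.2 (not_lt.2 (pulls_mono i (Finset.mem_Ico.1 ht).1))
  have h2 : ∑ t ∈ Finset.Ico 1 n, (if I t = i ∧ pulls I t i < pulls I n i then
      l * (X t - μ) - l ^ 2 / 2 else 0) =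
      ∑ t ∈ (Finset.Ico 1 n).filter (fun t => I t = i), (l * (X t - μ) - l ^ 2 / 2) := by
    rw [Finset.sum_filter]
    refine Finset.sum_congr rfl fun t ht => ?_
    by_cases h : I t = i
    · rw [if_pos h, if_pos ⟨h, pulls_lt_of_arm_eq ht h⟩]
    · rw [if_neg h, if_neg fun h' => h h'.1]
  have hc : ((Finset.Ico 1 n).filter (fun t => I t = i)).card = pulls I n i := rfl
  rw [logLik, ← Finset.sum_Ico_consecutive _ hn hnm, h1, h2, add_zero, Finset.sum_sub_distrib,
    ← Finset.mul_sum, Finset.sum_sub_distrib, Finset.sum_const, Finset.sum_const, hc, empMean,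
    nsmul_eq_mul, nsmul_eq_mul]
  field_simp

lemma measurable_pulls {Ω : Type*} {mΩ : MeasurableSpace Ω} {I : ℕ → Ω → Fin K} {n : ℕ}
    (hI : ∀ t ∈ Finset.Ico 1 n, Measurable (I t)) (i : Fin K) :
    Measurable (fun ω => pulls (fun t => I t ω) n i) := by
  simp only [pulls, Finset.card_filter]
  refine Finset.measurable_sum _ fun t ht => ?_
  exact Measurable.ite (hI t ht (measurableSet_singleton i)) measurable_const measurable_const

lemma measurableSet_active {Ω : Type*} {mΩ : MeasurableSpace Ω} {I : ℕ → Ω → Fin K} {n : ℕ}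
    (hI : ∀ t ∈ Finset.Ico 1 n, Measurable (I t)) (i : Fin K) (N : ℕ) :
    MeasurableSet {ω | pulls (fun t => I t ω) n i < N} :=
  measurable_pulls hI i (measurableSet_Iio (a := N))

lemma measurable_logLik {Ω : Type*} {mΩ : MeasurableSpace Ω} {I : ℕ → Ω → Fin K}
    {X : ℕ → Ω → ℝ} {n : ℕ} (hI : ∀ t ∈ Finset.Ico 1 n, Measurable (I t))
    (hX : ∀ t ∈ Finset.Ico 1 n, Measurable (X t)) (i : Fin K) (μ l : ℝ) (N : ℕ) :
    Measurable (fun ω => logLik (fun t => I t ω) (fun t => X t ω) i μ l N n) := by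
  refine Finset.measurable_sum _ fun t ht => Measurable.ite ?_ ?_ measurable_const
  · refine (hI t ht (measurableSet_singleton i)).inter (measurableSet_active (fun s hs => ?_) i N)
    rw [Finset.mem_Ico] at hs ht
    exact hI s (Finset.mem_Ico.2 ⟨hs.1, hs.2.trans ht.2⟩)
  · exact (((hX t ht).sub_const μ).const_mul l).sub_const _

end StoppedLikelihood

/-! ### Supermartingale property and deviation probabilities -/

section Run

variable {K : ℕ} {Ω : Type*} {mΩ : MeasurableSpace Ω} {ε₀ β : ℝ} {ν : Fin K → Measure ℝ}
  {P : Measure Ω} {ℱ : Filtration ℕ mΩ} {I : ℕ → Ω → Fin K} {X : ℕ → Ω → ℝ} {B C : ℕ → Ω → Fin K}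

lemma IsEBTCRun.measurable_arm_past (h : IsEBTCRun ε₀ β ν P ℱ I X B C) (n : ℕ) :
    ∀ t ∈ Finset.Ico 1 n, Measurable[ℱ n] (I t) := fun t ht =>
  (h.measurable_arm t (Finset.mem_Ico.1 ht).1).mono (ℱ.mono (Finset.mem_Ico.1 ht).2.le) le_rfl

lemma IsEBTCRun.measurable_reward_past (h : IsEBTCRun ε₀ β ν P ℱ I X B C) (n : ℕ) :
    ∀ t ∈ Finset.Ico 1 n, Measurable[ℱ n] (X t) := fun t ht =>
  (h.measurable_reward t (Finset.mem_Ico.1 ht).1).mono (ℱ.mono (Finset.mem_Ico.1 ht).2) le_rfl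

/-- Given the past and the arm, the reward has the law of that arm. -/
lemma IsEBTCRun.setLIntegral_mul (h : IsEBTCRun ε₀ β ν P ℱ I X B C) {n : ℕ} (hn : 1 ≤ n)
    (i : Fin K) {f : Ω → ENNReal} (hf : Measurable[ℱ n] f) {g : ℝ → ENNReal} (hg : Measurable g)
    {A : Set Ω} (hA : MeasurableSet[ℱ n] A) :
    ∫⁻ ω in A ∩ {ω | I n ω = i}, f ω * g (X n ω) ∂P =
      (∫⁻ ω in A ∩ {ω | I n ω = i}, f ω ∂P) * ∫⁻ x, g x ∂(ν i) := by
  have hX : Measurable (X n) := (h.measurable_reward n hn).mono (ℱ.le _) le_rfl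
  have hgX : Measurable (fun ω => g (X n ω)) := hg.comp hX
  have key : ∀ s : Set Ω, MeasurableSet[ℱ n] s →
      ∫⁻ ω in s ∩ {ω | I n ω = i}, g (X n ω) ∂P =
        P (s ∩ {ω | I n ω = i}) * ∫⁻ x, g x ∂(ν i) := by
    intro s hs
    have hmap : (P.restrict (s ∩ {ω | I n ω = i})).map (X n) =
        P (s ∩ {ω | I n ω = i}) • ν i := by
      ext u hu
      rw [Measure.map_apply hX hu, Measure.restrict_apply (hX hu), Set.inter_comm]
      exact h.reward_law n hn s hs i u hu
    rw [← lintegral_map hg hX, hmap, lintegral_smul_measure, smul_eq_mul]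
  -- The conditional law is given on events only; `key` extends it to functions of the reward, and
  -- this induction to past-measurable factors `f`.
  refine Measurable.ennreal_induction (motive := fun f =>
    ∫⁻ ω in A ∩ {ω | I n ω = i}, f ω * g (X n ω) ∂P =
      (∫⁻ ω in A ∩ {ω | I n ω = i}, f ω ∂P) * ∫⁻ x, g x ∂(ν i)) ?_ ?_ ?_ hf
  · intro c s hs
    have hs' := ℱ.le n s hs
    have e1 : ∀ ω, s.indicator (fun _ => c) ω * g (X n ω) =
        s.indicator (fun ω => c * g (X n ω)) ω := by
      intro ω; by_cases hω : ω ∈ s <;> simp [hω]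
    simp_rw [e1]
    rw [lintegral_indicator hs', lintegral_indicator hs', Measure.restrict_restrict hs',
      lintegral_const_mul _ hgX, lintegral_const, Measure.restrict_apply_univ,
      ← Set.inter_assoc, key _ (hs.inter hA), mul_assoc]
  · intro f₁ f₂ _ h₁ h₂ ih₁ ih₂
    have h₁' := h₁.mono (ℱ.le n) le_rfl
    simp only [Pi.add_apply, add_mul]
    have hm : Measurable (fun ω => f₁ ω * g (X n ω)) := h₁'.mul hgX
    rw [lintegral_add_left hm, ih₁, ih₂, lintegral_add_left h₁', add_mul]
  · intro f hf hmono ih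
    have hf' := fun k => (hf k).mono (ℱ.le n) le_rfl
    simp only [ENNReal.iSup_mul]
    have hm : ∀ k, Measurable (fun ω => f k ω * g (X n ω)) := fun k => (hf' k).mul hgX
    rw [lintegral_iSup hm
      (fun a b hab ω => mul_le_mul_left (hmono hab ω) _), lintegral_iSup hf' hmono,
      ENNReal.iSup_mul]
    exact iSup_congr ih

lemma lintegral_exp_le_one {ρ : Measure ℝ} (hρ : IsOneSubGaussian ρ) (l : ℝ) :
    ∫⁻ x, ENNReal.ofReal (Real.exp (l * (x - ∫ y, y ∂ρ) - l ^ 2 / 2)) ∂ρ ≤ 1 := by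
  have hint := (hρ.integrable_exp_mul l).mul_const (Real.exp (-(l ^ 2 / 2)))
  have hle := hρ.mgf_le l
  simp_rw [sub_eq_add_neg (l * _) (l ^ 2 / 2), Real.exp_add]
  rw [← ofReal_integral_eq_lintegral_ofReal hint (ae_of_all _ fun x => by positivity),
    integral_mul_const, ← ENNReal.ofReal_one]
  refine ENNReal.ofReal_le_ofReal ?_
  calc _ ≤ Real.exp (l ^ 2 / 2) * Real.exp (-(l ^ 2 / 2)) := by
        gcongr; simpa [mgf] using hle
    _ = 1 := by rw [← Real.exp_add]; simp

/-- The stopped exponential process is a supermartingale started at `1`. -/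
lemma IsEBTCRun.lintegral_logLik_le (h : IsEBTCRun ε₀ β ν P ℱ I X B C) [IsProbabilityMeasure P]
    {i : Fin K} (hν : IsOneSubGaussian (ν i)) (l : ℝ) (N : ℕ) {n : ℕ} (hn : 1 ≤ n) :
    ∫⁻ ω, ENNReal.ofReal (Real.exp
      (logLik (fun t => I t ω) (fun t => X t ω) i (armMean ν i) l N n)) ∂P ≤ 1 := by
  induction n, hn using Nat.le_induction with
  | base => simp [logLik]
  | succ n hn ih =>
    refine le_trans ?_ ih
    set Z : Ω → ENNReal := fun ω => ENNReal.ofReal (Real.exp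
      (logLik (fun t => I t ω) (fun t => X t ω) i (armMean ν i) l N n)) 
    have hZm : Measurable[ℱ n] Z := ENNReal.measurable_ofReal.comp (Real.measurable_exp.comp
      (measurable_logLik (h.measurable_arm_past n) (h.measurable_reward_past n) i _ l N))
    have hA : MeasurableSet[ℱ n] {ω | pulls (fun t => I t ω) n i < N} :=
      measurableSet_active (h.measurable_arm_past n) i N
    have hIi : MeasurableSet[ℱ n] {ω | I n ω = i} :=
      h.measurable_arm n hn (measurableSet_singleton i)
    have hAI := ℱ.le n _ (hA.inter hIi)
    rw [← lintegral_add_compl _ hAI, ← lintegral_add_compl Z hAI]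
    refine add_le_add ?_ (le_of_eq ?_)
    · have hg : Measurable (fun x : ℝ =>
          ENNReal.ofReal (Real.exp (l * (x - armMean ν i) - l ^ 2 / 2))) := by fun_prop
      have e := h.setLIntegral_mul hn i hZm hg hA
      calc _ = ∫⁻ ω in {ω | pulls (fun t => I t ω) n i < N} ∩ {ω | I n ω = i}, Z ω *
            ENNReal.ofReal (Real.exp (l * (X n ω - armMean ν i) - l ^ 2 / 2)) ∂P := by
            refine setLIntegral_congr_fun hAI fun ω hω => ?_
            change ENNReal.ofReal (Real.exp (logLik _ _ _ _ _ _ (n + 1))) =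
              ENNReal.ofReal (Real.exp (logLik _ _ _ _ _ _ n)) * _
            rw [logLik_succ _ _ _ _ _ _ hn, if_pos ⟨hω.2, hω.1⟩, Real.exp_add,
              ENNReal.ofReal_mul (Real.exp_nonneg _)]
        _ ≤ _ := by
            rw [e]
            exact mul_le_of_le_one_right zero_le (lintegral_exp_le_one hν l)
    · refine setLIntegral_congr_fun hAI.compl fun ω hω => ?_
      change ENNReal.ofReal (Real.exp (logLik _ _ _ _ _ _ (n + 1))) =
        ENNReal.ofReal (Real.exp (logLik _ _ _ _ _ _ n))
      rw [logLik_succ _ _ _ _ _ _ hn, if_neg fun h' => hω ⟨h'.2, h'.1⟩, add_zero]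

lemma IsEBTCRun.measurable_logLik (h : IsEBTCRun ε₀ β ν P ℱ I X B C) (i : Fin K) (μ l : ℝ)
    (N n : ℕ) :
    Measurable (fun ω => logLik (fun t => I t ω) (fun t => X t ω) i μ l N n) :=
  (EBTC.measurable_logLik (h.measurable_arm_past n) (h.measurable_reward_past n) i μ l N).mono
    (ℱ.le n) le_rfl

/-- Trajectories along which the stopped exponential process crosses the level that certifies a
deviation `x` of the mean of the first `N` rewards of arm `i` before round `n`. -/
def deviation (I : ℕ → Ω → Fin K) (X : ℕ → Ω → ℝ) (i : Fin K) (μ x : ℝ) (N n : ℕ) : Set Ω :=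
  {ω | (N : ℝ) * x ^ 2 / 2 ≤ logLik (fun t => I t ω) (fun t => X t ω) i μ x N n}

lemma IsEBTCRun.measurableSet_deviation (h : IsEBTCRun ε₀ β ν P ℱ I X B C) (i : Fin K)
    (μ x : ℝ) (N n : ℕ) : MeasurableSet (deviation I X i μ x N n) :=
  measurableSet_le measurable_const (h.measurable_logLik i μ x N n)

/-- Markov's inequality for a nonnegative variable of expectation at most `1`; taking the parameter
equal to the deviation `x` is the optimal Chernoff choice. -/
lemma IsEBTCRun.measureReal_deviation_le (h : IsEBTCRun ε₀ β ν P ℱ I X B C)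
    [IsProbabilityMeasure P] {i : Fin K} (hν : IsOneSubGaussian (ν i)) (x : ℝ) (N : ℕ) {n : ℕ}
    (hn : 1 ≤ n) :
    P.real (deviation I X i (armMean ν i) x N n) ≤ Real.exp (-((N : ℝ) * x ^ 2 / 2)) := by
  have hm := mul_meas_ge_le_lintegral (μ := P) (ENNReal.measurable_ofReal.comp
    (Real.measurable_exp.comp (h.measurable_logLik i (armMean ν i) x N n)))
    (ENNReal.ofReal (Real.exp ((N : ℝ) * x ^ 2 / 2)))
  have hset : {ω | ENNReal.ofReal (Real.exp ((N : ℝ) * x ^ 2 / 2)) ≤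
      (ENNReal.ofReal ∘ Real.exp ∘ fun ω => logLik (fun t => I t ω) (fun t => X t ω) i
        (armMean ν i) x N n) ω} = deviation I X i (armMean ν i) x N n := by
    ext ω
    simp [deviation, ENNReal.ofReal_le_ofReal_iff (Real.exp_nonneg _)]
  rw [hset] at hm
  have h1 := ENNReal.toReal_mono ENNReal.one_ne_top (hm.trans (h.lintegral_logLik_le hν x N hn))
  rw [ENNReal.toReal_mul, ENNReal.toReal_ofReal (Real.exp_nonneg _), ENNReal.toReal_one] at h1
  rw [Real.exp_neg, ← one_div, le_div_iff₀ (Real.exp_pos _), mul_comm]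
  exact h1

/-- Outside the deviation events, the empirical mean is within its confidence width. -/
lemma abs_empMean_sub_lt {I : ℕ → Ω → Fin K} {X : ℕ → Ω → ℝ} {i : Fin K} {μ x : ℝ} {n m : ℕ}
    {ω : Ω} (hn : 1 ≤ n) (hnm : n ≤ m) (hp : 1 ≤ pulls (fun t => I t ω) n i) (hx : 0 < x)
    (h1 : ω ∉ deviation I X i μ x (pulls (fun t => I t ω) n i) m)
    (h2 : ω ∉ deviation I X i μ (-x) (pulls (fun t => I t ω) n i) m) :
    |empMean (fun t => I t ω) (fun t => X t ω) n i - μ| < x := by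
  have hp' : (0 : ℝ) < pulls (fun t => I t ω) n i := by exact_mod_cast hp
  simp only [deviation, Set.mem_ofPred_eq, not_le, logLik_eq _ _ _ _ _ hn hnm hp, mul_div_assoc,
    mul_lt_mul_iff_right₀ hp'] at h1 h2
  rw [abs_lt]
  constructor <;> nlinarith

end Run

end EBTC
namespace EBTC

/-! ### Elementary properties of the gaps -/

section Gaps

variable {K : ℕ} (ν : Fin K → Measure ℝ)

lemma armMean_le_bestMean (i : Fin K) : armMean ν i ≤ bestMean ν :=
  le_ciSup (Set.finite_range _).bddAbove i

lemma gap_nonneg (i : Fin K) : 0 ≤ gap ν i := sub_nonneg.2 (armMean_le_bestMean ν i)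

lemma gap_le_maxGap (i : Fin K) : gap ν i ≤ maxGap ν := le_ciSup (Set.finite_range _).bddAbove i

lemma maxGap_nonneg (hK : 0 < K) : 0 ≤ maxGap ν :=
  (gap_nonneg ν ⟨0, hK⟩).trans (gap_le_maxGap ν _)

lemma exists_armMean_eq_bestMean (hK : 0 < K) : ∃ s, armMean ν s = bestMean ν := by
  have : Nonempty (Fin K) := ⟨⟨0, hK⟩⟩
  exact exists_eq_ciSup_of_finite

lemma minGap_le {i : Fin K} (hi : 0 < gap ν i) : minGap ν ≤ gap ν i :=
  csInf_le ⟨0, by rintro x ⟨j, hj, rfl⟩; exact hj.le⟩ ⟨i, hi, rfl⟩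

lemma minGap_pos (h : ∃ i, 0 < gap ν i) : 0 < minGap ν := by
  obtain ⟨i, hi⟩ := h
  have hfin : {x : ℝ | ∃ i, 0 < gap ν i ∧ x = gap ν i}.Finite :=
    (Set.finite_range (gap ν)).subset (by rintro x ⟨j, -, rfl⟩; exact ⟨j, rfl⟩)
  have hne : {x : ℝ | ∃ i, 0 < gap ν i ∧ x = gap ν i}.Nonempty := ⟨_, i, hi, rfl⟩
  obtain ⟨j, hj, h⟩ := hne.csInf_mem hfin
  rw [minGap, h]
  exact hj

end Gaps

/-! ### From levels to counts, and a geometric sum -/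

section Sums

/-- The first good level from `D₀` on is `D₀` plus a number of consecutive failing levels. A window
of length `T` suffices: if all of it fails, the right-hand side already exceeds `M ≤ T`, as `1 ≤ a`.
-/
lemma le_of_levels {F : ℕ → Prop} [DecidablePred F] {a b M T : ℕ} (D₀ : ℕ) (ha : 1 ≤ a)
    (hM : M ≤ T) (h : ∀ D, ¬ F D → M ≤ a * D + b) :
    M ≤ a * D₀ + b + a * ((Finset.Ico D₀ (D₀ + T)).filter F).card := by
  by_cases hex : ∃ k, ¬ F (D₀ + k)
  · have hspec := h _ (Nat.find_spec hex)
    have hmin : ∀ k < Nat.find hex, F (D₀ + k) := fun k hk => not_not.1 (Nat.find_min hex hk)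
    rcases le_total (Nat.find hex) T with hT | hT
    · have hsub : Finset.Ico D₀ (D₀ + Nat.find hex) ⊆ (Finset.Ico D₀ (D₀ + T)).filter F := by
        intro D hD
        rw [Finset.mem_Ico] at hD
        refine Finset.mem_filter.2 ⟨Finset.mem_Ico.2 ⟨hD.1, by omega⟩, ?_⟩
        have := hmin (D - D₀) (by omega)
        rwa [Nat.add_sub_cancel' hD.1] at this
      have hc := Finset.card_le_card hsub
      rw [Nat.card_Ico, Nat.add_sub_cancel_left] at hc
      nlinarith
    · have hall : (Finset.Ico D₀ (D₀ + T)).filter F = Finset.Ico D₀ (D₀ + T) := by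
        refine Finset.filter_true_of_mem fun D hD => ?_
        rw [Finset.mem_Ico] at hD
        have := hmin (D - D₀) (by omega)
        rwa [Nat.add_sub_cancel' hD.1] at this
      rw [hall, Nat.card_Ico, Nat.add_sub_cancel_left]
      nlinarith
  · push Not at hex
    have hall : (Finset.Ico D₀ (D₀ + T)).filter F = Finset.Ico D₀ (D₀ + T) := by
      refine Finset.filter_true_of_mem fun D hD => ?_
      have := hex (D - D₀)
      rwa [Nat.add_sub_cancel' (Finset.mem_Ico.1 hD).1] at this
    rw [hall, Nat.card_Ico, Nat.add_sub_cancel_left]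
    nlinarith

lemma sum_exp_neg_le {b : ℝ} (hb : 0 < b) (T : ℕ) :
    ∑ j ∈ Finset.range T, Real.exp (-(b * j)) ≤ 1 + 1 / b := by
  have hq : Real.exp (-b) < 1 := by simpa using hb
  have h1 : ∑ j ∈ Finset.range T, Real.exp (-(b * j)) = ∑ j ∈ Finset.range T, Real.exp (-b) ^ j :=
    Finset.sum_congr rfl fun j _ => by rw [← Real.exp_nat_mul]; congr 1; ring
  rw [h1]
  have hgeom : ∑ j ∈ Finset.range T, Real.exp (-b) ^ j ≤ 1 / (1 - Real.exp (-b)) := by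
    rw [le_div_iff₀ (by linarith), mul_comm, mul_neg_geom_sum]
    linarith [pow_pos (Real.exp_pos (-b)) T]
  refine hgeom.trans ?_
  have h2 : Real.exp (-b) * (1 + b) ≤ 1 := by
    have := Real.add_one_le_exp b
    calc Real.exp (-b) * (1 + b) ≤ Real.exp (-b) * Real.exp b := by gcongr; linarith
      _ = 1 := by rw [← Real.exp_add]; simp
  rw [div_le_iff₀ (by linarith)]
  have e : (1 + 1 / b) * (1 - Real.exp (-b)) =
      1 + (1 - Real.exp (-b) * (1 + b)) / b := by field_simp; ring
  rw [e]
  have : 0 ≤ (1 - Real.exp (-b) * (1 + b)) / b := div_nonneg (by linarith) hb.le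
  linarith

end Sums

/-! ### Failure probability, expected regret and its order of magnitude -/

section Regret

variable {K : ℕ} {Ω : Type*} {mΩ : MeasurableSpace Ω} {ε₀ : ℝ} {ν : Fin K → Measure ℝ}
  {P : Measure Ω} {ℱ : Filtration ℕ mΩ} {I : ℕ → Ω → Fin K} {X : ℕ → Ω → ℝ} {B C : ℕ → Ω → Fin K}

/-- Trajectories along which, up to round `T`, some empirical mean leaves its confidence width at
level `D`. -/
def failure (I : ℕ → Ω → Fin K) (X : ℕ → Ω → ℝ) (μ : Fin K → ℝ) (m : ℝ) (T D : ℕ) : Set Ω :=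
  ⋃ i, ⋃ N ∈ Finset.Icc 1 T, (deviation I X i (μ i) (width m D N) N (T + 1) ∪
    deviation I X i (μ i) (-width m D N) N (T + 1))

lemma IsEBTCRun.measurableSet_failure {β : ℝ} (h : IsEBTCRun ε₀ β ν P ℱ I X B C)
    (μ : Fin K → ℝ) (m : ℝ) (T D : ℕ) : MeasurableSet (failure I X μ m T D) :=
  MeasurableSet.iUnion fun i => Finset.measurableSet_biUnion _ fun N _ =>
    (h.measurableSet_deviation i _ _ N _).union (h.measurableSet_deviation i _ _ N _)

lemma IsEBTCRun.measureReal_failure_le {β : ℝ} (h : IsEBTCRun ε₀ β ν P ℱ I X B C)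
    [IsProbabilityMeasure P] (hν : ∀ i, IsOneSubGaussian (ν i)) {m : ℝ} (hm : 0 < m) (T D : ℕ) :
    P.real (failure I X (armMean ν) m T D) ≤
      2 * K * (1 + 64 / m ^ 2) * Real.exp (-(m ^ 2 / 64 * D)) := by
  have hdev : ∀ (i : Fin K), ∀ N ∈ Finset.Icc 1 T,
      P.real (deviation I X i (armMean ν i) (width m D N) N (T + 1) ∪
        deviation I X i (armMean ν i) (-width m D N) N (T + 1)) ≤
      2 * Real.exp (-(m ^ 2 / 64 * D)) * Real.exp (-(m ^ 2 / 64 * N)) := by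
    intro i N hN
    have hN1 := (Finset.mem_Icc.1 hN).1
    have h1 := h.measureReal_deviation_le (hν i) (width m D N) N (Nat.le_add_left 1 T)
    have h2 := h.measureReal_deviation_le (hν i) (-width m D N) N (Nat.le_add_left 1 T)
    rw [neg_sq] at h2
    rw [mul_sq_width m D hN1] at h1 h2
    -- The maximum is at least the average of `N` and `D`, which halves the rate and decouples the
    -- sum over `N` from the decay in `D`.
    have h3 : Real.exp (-(m ^ 2 / 32 * (max N D : ℕ))) ≤
        Real.exp (-(m ^ 2 / 64 * D)) * Real.exp (-(m ^ 2 / 64 * N)) := by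
      rw [← Real.exp_add, Real.exp_le_exp]
      have e1 : (N : ℝ) ≤ (max N D : ℕ) := by exact_mod_cast le_max_left N D
      have e2 : (D : ℝ) ≤ (max N D : ℕ) := by exact_mod_cast le_max_right N D
      nlinarith [sq_nonneg m]
    linarith [measureReal_union_le (μ := P) (deviation I X i (armMean ν i) (width m D N) N (T + 1))
      (deviation I X i (armMean ν i) (-width m D N) N (T + 1))]
  have hsum : ∑ N ∈ Finset.Icc 1 T, Real.exp (-(m ^ 2 / 64 * N)) ≤ 1 + 64 / m ^ 2 := by
    have h1 := sum_exp_neg_le (b := m ^ 2 / 64) (by positivity) (T + 1)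
    rw [one_div_div] at h1
    refine le_trans (Finset.sum_le_sum_of_subset_of_nonneg ?_ fun _ _ _ => Real.exp_nonneg _) h1
    intro N hN
    simp only [Finset.mem_Icc, Finset.mem_range] at hN ⊢
    omega
  calc P.real (failure I X (armMean ν) m T D)
      ≤ ∑ i : Fin K, ∑ N ∈ Finset.Icc 1 T,
          2 * Real.exp (-(m ^ 2 / 64 * D)) * Real.exp (-(m ^ 2 / 64 * N)) := by
        refine (measureReal_iUnion_fintype_le _).trans (Finset.sum_le_sum fun i _ => ?_)
        exact (measureReal_biUnion_finset_le _ _).trans (Finset.sum_le_sum (hdev i))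
    _ ≤ ∑ i : Fin K, 2 * Real.exp (-(m ^ 2 / 64 * D)) * (1 + 64 / m ^ 2) := by
        refine Finset.sum_le_sum fun i _ => ?_
        rw [← Finset.mul_sum]
        gcongr
    _ = _ := by
        rw [Finset.sum_const, Finset.card_univ, Fintype.card_fin, nsmul_eq_mul]
        ring

lemma IsEBTCRun.card_subopt_le (h : IsEBTCRun ε₀ (1 / 2) ν P ℱ I X B C) (hK : 0 < K) {m : ℝ}
    (hm : 0 < m) (hmε : m ≤ ε₀) (hgap : ∀ i, 0 < gap ν i → m ≤ gap ν i) {T D : ℕ} {ω : Ω}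
    (hω : ω ∉ failure I X (armMean ν) m T D) :
    ((Finset.Icc (K + 1) T).filter (fun n => 0 < gap ν (B n ω))).card ≤ K ^ 2 * (8 * D + 3) := by
  obtain ⟨s, hs⟩ := exists_armMean_eq_bestMean ν hK
  have hfol := h.follows ω
  refine hfol.card_subopt_le (μ := armMean ν) hm hmε (s := s) ?_ ?_ ?_
  · intro n hn
    exact (Finset.mem_Icc.1 (Finset.mem_filter.1 hn).1).1
  · intro n hn i
    obtain ⟨h1, h2⟩ := Finset.mem_Icc.1 (Finset.mem_filter.1 hn).1
    have hp := hfol.one_le_pulls (n := n) h1 i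
    have hle : pulls (fun t => I t ω) n i ∈ Finset.Icc 1 T :=
      Finset.mem_Icc.2 ⟨hp, (pulls_le n i).trans (by omega)⟩
    simp only [failure, Set.mem_iUnion, Set.mem_union, not_exists, not_or] at hω
    obtain ⟨h3, h4⟩ := hω i _ hle
    exact abs_empMean_sub_lt (by omega) (by omega) hp (width_pos hm D hp) h3 h4
  · intro n hn
    rw [hs]
    exact hgap _ (Finset.mem_filter.1 hn).2

open Classical in
lemma IsEBTCRun.sum_gap_le (h : IsEBTCRun ε₀ (1 / 2) ν P ℱ I X B C) (hK : 0 < K) {m : ℝ}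
    (hm : 0 < m) (hmε : m ≤ ε₀) (hgap : ∀ i, 0 < gap ν i → m ≤ gap ν i) (T D₀ : ℕ) (ω : Ω) :
    ∑ n ∈ Finset.Icc (K + 1) T, gap ν (B n ω) ≤
      maxGap ν * (K ^ 2 * (8 * D₀ + 3) + 8 * K ^ 2 * ∑ D ∈ Finset.Ico D₀ (D₀ + T),
        (failure I X (armMean ν) m T D).indicator (fun _ => (1 : ℝ)) ω) := by
  have hcount := le_of_levels (F := fun D => ω ∈ failure I X (armMean ν) m T D)
    (a := 8 * K ^ 2) (b := 3 * K ^ 2) (T := T) D₀ (by nlinarith)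
    (((Finset.card_filter_le (Finset.Icc (K + 1) T) fun n => 0 < gap ν (B n ω))).trans
      (by rw [Nat.card_Icc]; omega))
    (fun D hD => (h.card_subopt_le hK hm hmε hgap hD).trans (by nlinarith))
  have hind : ∑ D ∈ Finset.Ico D₀ (D₀ + T),
      (failure I X (armMean ν) m T D).indicator (fun _ => (1 : ℝ)) ω =
      ((Finset.Ico D₀ (D₀ + T)).filter
        (fun D => ω ∈ failure I X (armMean ν) m T D)).card := by
    simp [Set.indicator_apply]
  calc ∑ n ∈ Finset.Icc (K + 1) T, gap ν (B n ω)
      ≤ ∑ n ∈ Finset.Icc (K + 1) T, if 0 < gap ν (B n ω) then maxGap ν else 0 := by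
        refine Finset.sum_le_sum fun n _ => ?_
        split_ifs with hg
        · exact gap_le_maxGap ν _
        · exact not_lt.1 hg
    _ = maxGap ν * ((Finset.Icc (K + 1) T).filter (fun n => 0 < gap ν (B n ω))).card := by
        rw [← Finset.sum_filter, Finset.sum_const, nsmul_eq_mul, mul_comm]
    _ ≤ _ := by
        refine mul_le_mul_of_nonneg_left ?_ (maxGap_nonneg ν hK)
        rw [hind]
        refine (Nat.cast_le (α := ℝ).2 hcount).trans (le_of_eq ?_)
        push_cast
        ring

/-- Of the two factors `1 + 64 / m ^ 2`, one comes from the sum over pull counts and the other from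
the sum over levels above `D₀`. -/
lemma IsEBTCRun.inducedRegret_le_of_level (h : IsEBTCRun ε₀ (1 / 2) ν P ℱ I X B C)
    [IsProbabilityMeasure P] (hν : ∀ i, IsOneSubGaussian (ν i)) (hK : 0 < K) {m : ℝ}
    (hm : 0 < m) (hmε : m ≤ ε₀) (hgap : ∀ i, 0 < gap ν i → m ≤ gap ν i) (T D₀ : ℕ) :
    inducedRegret ν P B T ≤ maxGap ν * (K ^ 2 * (8 * D₀ + 3) +
      16 * K ^ 3 * (1 + 64 / m ^ 2) ^ 2 * Real.exp (-(m ^ 2 / 64 * D₀))) := by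
  have hB : ∀ n ∈ Finset.Icc (K + 1) T, Integrable (fun ω => gap ν (B n ω)) P := by
    intro n hn
    have hBm : Measurable (B n) :=
      (h.measurable_leader n (Finset.mem_Icc.1 hn).1).mono (ℱ.le n) le_rfl
    refine Integrable.of_bound
      ((measurable_of_countable (gap ν)).comp hBm).aestronglyMeasurable (maxGap ν)
      (ae_of_all _ fun ω => ?_)
    rw [Real.norm_of_nonneg (gap_nonneg ν _)]
    exact gap_le_maxGap ν _
  have hF : ∀ D ∈ Finset.Ico D₀ (D₀ + T), Integrable
      ((failure I X (armMean ν) m T D).indicator (fun _ => (1 : ℝ))) P := fun D _ =>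
    (integrable_const 1).indicator (h.measurableSet_failure (armMean ν) m T D)
  have hFs := integrable_finsetSum _ hF
  have hreg : inducedRegret ν P B T = ∫ ω, ∑ n ∈ Finset.Icc (K + 1) T, gap ν (B n ω) ∂P :=
    (integral_finsetSum _ hB).symm
  have hsum : ∑ D ∈ Finset.Ico D₀ (D₀ + T), Real.exp (-(m ^ 2 / 64 * D)) ≤
      Real.exp (-(m ^ 2 / 64 * D₀)) * (1 + 64 / m ^ 2) := by
    have h1 := sum_exp_neg_le (b := m ^ 2 / 64) (by positivity) T
    rw [one_div_div] at h1
    rw [Finset.sum_Ico_eq_sum_range, Nat.add_sub_cancel_left]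
    calc _ = Real.exp (-(m ^ 2 / 64 * D₀)) *
          ∑ j ∈ Finset.range T, Real.exp (-(m ^ 2 / 64 * j)) := by
          rw [Finset.mul_sum]
          refine Finset.sum_congr rfl fun j _ => ?_
          rw [← Real.exp_add]
          push_cast
          ring_nf
      _ ≤ _ := by gcongr
  have hbound : ∑ D ∈ Finset.Ico D₀ (D₀ + T), P.real (failure I X (armMean ν) m T D) ≤
      2 * K * (1 + 64 / m ^ 2) * (Real.exp (-(m ^ 2 / 64 * D₀)) * (1 + 64 / m ^ 2)) := by
    refine (Finset.sum_le_sum fun D _ => h.measureReal_failure_le hν hm T D).trans ?_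
    rw [← Finset.mul_sum]
    gcongr
  rw [hreg]
  calc _ ≤ ∫ ω, maxGap ν * (K ^ 2 * (8 * D₀ + 3) + 8 * K ^ 2 * ∑ D ∈ Finset.Ico D₀ (D₀ + T),
        (failure I X (armMean ν) m T D).indicator (fun _ => (1 : ℝ)) ω) ∂P :=
        integral_mono (integrable_finsetSum _ hB)
          (((integrable_const _).add (hFs.const_mul _)).const_mul _)
          (h.sum_gap_le hK hm hmε hgap T D₀)
    _ = maxGap ν * (K ^ 2 * (8 * D₀ + 3) + 8 * K ^ 2 * ∑ D ∈ Finset.Ico D₀ (D₀ + T),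
        P.real (failure I X (armMean ν) m T D)) := by
        rw [integral_const_mul, integral_add (integrable_const _) (hFs.const_mul _),
          integral_const, integral_const_mul, integral_finsetSum _ hF]
        simp [integral_indicator_const, h.measurableSet_failure]
    _ ≤ maxGap ν * (K ^ 2 * (8 * D₀ + 3) + 8 * K ^ 2 *
        (2 * K * (1 + 64 / m ^ 2) * (Real.exp (-(m ^ 2 / 64 * D₀)) * (1 + 64 / m ^ 2)))) := by
        have := maxGap_nonneg ν hK
        gcongr
    _ = _ := by ring

/-- Explicit bound on the regret, uniform in the horizon. -/
lemma IsEBTCRun.inducedRegret_le (h : IsEBTCRun ε₀ (1 / 2) ν P ℱ I X B C)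
    [IsProbabilityMeasure P] (hν : ∀ i, IsOneSubGaussian (ν i)) (hK : 0 < K) {m : ℝ}
    (hm : 0 < m) (hmε : m ≤ ε₀) (hgap : ∀ i, 0 < gap ν i → m ≤ gap ν i) (T : ℕ) :
    inducedRegret ν P B T ≤ maxGap ν * (K ^ 2 *
      (8 * (64 / m ^ 2) * Real.log (K * (1 + 64 / m ^ 2)) + 27 + 16 * (64 / m ^ 2))) := by
  set u := 64 / m ^ 2 with hu
  have hu0 : 0 < u := by positivity
  have hK1 : (1 : ℝ) ≤ K := by exact_mod_cast hK
  have hKu : 1 ≤ K * (1 + u) := by nlinarith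
  -- Chosen so that the exponential decay at `D₀` cancels one factor `K * (1 + u)` of the failure
  -- term, which leaves order `K ^ 2 * (1 + u)`.
  set D₀ := ⌈u * Real.log (K * (1 + u))⌉₊ with hD
  have hlog := Real.log_nonneg hKu
  have hD1 : u * Real.log (K * (1 + u)) ≤ D₀ := Nat.le_ceil _
  have hD2 : (D₀ : ℝ) < u * Real.log (K * (1 + u)) + 1 := Nat.ceil_lt_add_one (by positivity)
  refine (h.inducedRegret_le_of_level hν hK hm hmε hgap T D₀).trans
    (mul_le_mul_of_nonneg_left ?_ (maxGap_nonneg ν hK))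
  rw [← hu]
  have hexp : Real.exp (-(m ^ 2 / 64 * D₀)) ≤ (K * (1 + u))⁻¹ := by
    rw [← Real.exp_log (show 0 < K * (1 + u) by positivity), ← Real.exp_neg, Real.exp_le_exp,
      neg_le_neg_iff]
    calc Real.log (K * (1 + u)) = m ^ 2 / 64 * (u * Real.log (K * (1 + u))) := by
          rw [hu]; field_simp
      _ ≤ _ := by gcongr
  calc K ^ 2 * (8 * (D₀ : ℝ) + 3) + 16 * K ^ 3 * (1 + u) ^ 2 * Real.exp (-(m ^ 2 / 64 * D₀))
      ≤ K ^ 2 * (8 * (u * Real.log (K * (1 + u)) + 1) + 3) +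
        16 * K ^ 3 * (1 + u) ^ 2 * (K * (1 + u))⁻¹ := by gcongr
    _ = K ^ 2 * (8 * (u * Real.log (K * (1 + u)) + 1) + 3) + 16 * K ^ 2 * (1 + u) := by
        field_simp
    _ = _ := by ring

/-- When `m` is large, `log K` is not controlled by `log (K / m ^ 2)`; the third power of `K` pays
for it. The condition `κ ≤ K / m ^ 2` keeps the logarithm away from zero, so that its square absorbs
constant and linear terms. -/
lemma level_bound_le {κ K m : ℝ} (hκ : 1 < κ) (hK : 1 ≤ K) (hm : 0 < m) (h : κ ≤ K / m ^ 2) :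
    K ^ 2 * (8 * (64 / m ^ 2) * Real.log (K * (1 + 64 / m ^ 2)) + 27 + 16 * (64 / m ^ 2)) ≤
      (34331 / Real.log κ ^ 2 + 512 / Real.log κ) *
        (K ^ 3 / m ^ 2 * Real.log (K / m ^ 2) ^ 2) := by
  set ρ := K / m ^ 2 with hρ
  have hρ1 : 1 ≤ ρ := hκ.le.trans h
  have hu : 64 / m ^ 2 = 64 * ρ / K := by rw [hρ]; field_simp
  have hl : 0 < Real.log κ := Real.log_pos hκ
  have hL : Real.log κ ≤ Real.log ρ := Real.log_le_log (by linarith) h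
  have hL0 := hl.trans_le hL
  have hlog : Real.log (K * (1 + 64 * ρ / K)) ≤ K * (65 + Real.log ρ) := by
    have h1 : Real.log K ≤ K - 1 := Real.log_le_sub_one_of_pos (by linarith)
    have h2 : Real.log (65 * ρ) ≤ 64 + Real.log ρ := by
      rw [Real.log_mul (by norm_num) (by linarith)]
      have := Real.log_le_sub_one_of_pos (show (0 : ℝ) < 65 by norm_num)
      linarith
    have h3 : 64 * ρ / K ≤ 64 * ρ := div_le_self (by linarith) hK
    have h4 : Real.log (1 + 64 * ρ / K) ≤ Real.log (65 * ρ) :=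
      Real.log_le_log (by positivity) (by linarith)
    rw [Real.log_mul (by linarith) (by positivity)]
    nlinarith
  have hρK : K ^ 3 / m ^ 2 = K ^ 2 * ρ := by rw [hρ]; ring
  rw [hu, hρK]
  calc K ^ 2 * (8 * (64 * ρ / K) * Real.log (K * (1 + 64 * ρ / K)) + 27 + 16 * (64 * ρ / K))
      ≤ K ^ 2 * (8 * (64 * ρ / K) * (K * (65 + Real.log ρ)) + 27 * ρ + 16 * (64 * ρ)) := by
        have h3 : 64 * ρ / K ≤ 64 * ρ := div_le_self (by linarith) hK
        gcongr
        linarith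
    -- `34331 = 8 * 64 * 65 + 27 + 16 * 64` and `512 = 8 * 64`.
    _ = K ^ 2 * ρ * (34331 + 512 * Real.log ρ) := by field_simp; ring
    _ ≤ K ^ 2 * ρ * ((34331 / Real.log κ ^ 2 + 512 / Real.log κ) * Real.log ρ ^ 2) := by
        have e1 : 34331 ≤ 34331 / Real.log κ ^ 2 * Real.log ρ ^ 2 := by
          rw [div_mul_eq_mul_div, le_div_iff₀ (by positivity)]
          gcongr
        have e2 : 512 * Real.log ρ ≤ 512 / Real.log κ * Real.log ρ ^ 2 := by
          rw [div_mul_eq_mul_div, le_div_iff₀ hl, sq, ← mul_assoc]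
          gcongr
        gcongr
        linarith
    _ = _ := by ring

lemma inducedRegret_eq_zero (hgap : ¬ ∃ i, 0 < gap ν i) (T : ℕ) : inducedRegret ν P B T = 0 := by
  push Not at hgap
  refine Finset.sum_eq_zero fun n _ => ?_
  have : ∀ ω, bestMean ν - armMean ν (B n ω) = 0 := fun ω =>
    le_antisymm (hgap (B n ω)) (gap_nonneg ν _)
  simp [this]

end Regret

end EBTC

theorem mainTheorem6 :
    -- the regret is bounded by a constant independent of the horizon, on every instance
    (∀ (K : ℕ), 2 ≤ K → ∀ (ε₀ : ℝ), 0 < ε₀ →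
      ∀ (ν : Fin K → MeasureTheory.Measure ℝ),
        (∀ i, MeasureTheory.IsProbabilityMeasure (ν i)) → (∀ i, EBTC.IsOneSubGaussian (ν i)) →
      ∃ R : ℝ,
        ∀ {Ω : Type*} {mΩ : MeasurableSpace Ω} (P : MeasureTheory.Measure Ω)
          (_ : MeasureTheory.IsProbabilityMeasure P) (ℱ : MeasureTheory.Filtration ℕ mΩ)
          (I : ℕ → Ω → Fin K) (X : ℕ → Ω → ℝ) (B C : ℕ → Ω → Fin K),
          EBTC.IsEBTCRun ε₀ (1 / 2) ν P ℱ I X B C →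
          ∀ T : ℕ, K < T → EBTC.inducedRegret ν P B T ≤ R) ∧
    -- the order of magnitude of the constant
    (∀ κ : ℝ, 1 < κ → ∃ c : ℝ, 0 < c ∧
      ∀ (K : ℕ), 2 ≤ K → ∀ (ε₀ : ℝ), 0 < ε₀ →
      ∀ (ν : Fin K → MeasureTheory.Measure ℝ),
        (∀ i, MeasureTheory.IsProbabilityMeasure (ν i)) → (∀ i, EBTC.IsOneSubGaussian (ν i)) →
        (∃ i, 0 < EBTC.gap ν i) →
        κ ≤ (K : ℝ) / (min (EBTC.minGap ν) ε₀) ^ 2 →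
        ∀ {Ω : Type*} {mΩ : MeasurableSpace Ω} (P : MeasureTheory.Measure Ω)
          (_ : MeasureTheory.IsProbabilityMeasure P) (ℱ : MeasureTheory.Filtration ℕ mΩ)
          (I : ℕ → Ω → Fin K) (X : ℕ → Ω → ℝ) (B C : ℕ → Ω → Fin K),
          EBTC.IsEBTCRun ε₀ (1 / 2) ν P ℱ I X B C →
          ∀ T : ℕ, K < T →
            EBTC.inducedRegret ν P B T ≤
              c * ((K : ℝ) ^ 3 * EBTC.maxGap ν / (min (EBTC.minGap ν) ε₀) ^ 2 *
                (Real.log ((K : ℝ) / (min (EBTC.minGap ν) ε₀) ^ 2)) ^ 2)) := by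
  refine ⟨?_, ?_⟩
  · intro K hK ε₀ hε ν _ hν
    by_cases hgap : ∃ i, 0 < EBTC.gap ν i
    · have hm := lt_min (EBTC.minGap_pos ν hgap) hε
      refine ⟨_, fun P _ ℱ I X B C h T _ => h.inducedRegret_le hν (by omega) hm
        (min_le_right _ _) (fun i hi => (min_le_left _ _).trans (EBTC.minGap_le ν hi)) T⟩
    -- With equal means there is no positive gap to set the scale `m`, but every recommendation is
    -- optimal.
    · exact ⟨0, fun P _ ℱ I X B C h T _ => (EBTC.inducedRegret_eq_zero hgap T).le⟩
  · intro κ hκ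
    have hl := Real.log_pos hκ
    refine ⟨34331 / Real.log κ ^ 2 + 512 / Real.log κ, by positivity, ?_⟩
    intro K hK ε₀ hε ν _ hν hgap hκm Ω _ P _ ℱ I X B C h T _
    have hm := lt_min (EBTC.minGap_pos ν hgap) hε
    refine (h.inducedRegret_le hν (by omega) hm (min_le_right _ _)
      (fun i hi => (min_le_left _ _).trans (EBTC.minGap_le ν hi)) T).trans ?_
    have hK1 : (1 : ℝ) ≤ K := by exact_mod_cast (by omega : 1 ≤ K)
    refine (mul_le_mul_of_nonneg_left (EBTC.level_bound_le hκ hK1 hm hκm)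
      (EBTC.maxGap_nonneg ν (by omega))).trans (le_of_eq ?_)
    ring
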